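/- Let $d$ be an even natural number and let $\mathbf F,\mathbf G$ be probability distributions on $\mathbb R^{d}$, with $\mathbf X=(X_1,\dots,X_d)\sim\mathbf F$ and $\mathbf Y=(Y_1,\dots,Y_d)\sim\mathbf G$. Let $\gamma:[0,\infty)\to[0,\infty)$ be continuous and increasing with $\gamma(0)=0$, differentiable on $(0,\infty)$ with a non-constant, completely monotone derivative there (that is, $\gamma'$ is smooth and $(-1)^m(\gamma')^{(m)}\ge 0$ on $(0,\infty)$ for all $m\ge 0$). For a two-element set $\{i,j\}\subseteq\{1,\dots,d\}$ put $\mathbf X_{\{i,j\}}=(X_i,X_j)$, $\mathbf Y_{\{i,j\}}=(Y_i,Y_j)$, with distributions $\mathbf F_{\{i,j\}}$, $\mathbf G_{\{i,j\}}$, and $$\mathcal E_{\{i,j\}}=2\,\mathrm E\,\gamma\big(\tfrac12\|\mathbf X_{1,\{i,j\}}-\mathbf Y_{1,\{i,j\}}\|^2\big)-\mathrm E\,\gamma\big(\tfrac12\|\mathbf X_{1,\{i,j\}}-\mathbf X_{2,\{i,j\}}\|^2\big)-\mathrm E\,\gamma\big(\tfrac12\|\mathbf Y_{1,\{i,j\}}-\mathbf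 Y_{2,\{i,j\}}\|^2\big),$$ where $\mathbf X_1,\mathbf X_2\sim\mathbf F$ and $\mathbf Y_1,\mathbf Y_2\sim\mathbf G$ are independent and $\|\cdot\|$ is the Euclidean norm; all these expectations are assumed to be finite. Let $\mathcal P$ be the set of perfect pairings, i.e. partitions of $\{1,\dots,d\}$ into two-element sets, and for $P\in\mathcal P$ let $\mathcal E(P)=\sum_{p\in P}\mathcal E_{p}$. Let $i_1,\dots,i_s,j_1,\dots,j_s$ be distinct elements of $\{1,\dots,d\}$ (with $s\ge 0$), let $S=\{\{i_1,j_1\},\dots,\{i_s,j_s\}\}$ be the set of signal pairs and $N=\{1,\dots,d\}\setminus\{i_1,\dots,i_s,j_1,\dots,j_s\}$ the set of noise coordinates. Assume that 1. $X_k$ and $Y_k$ have the same distribution for every $1\le k\le d$; 2. $\mathbf F_p\neq\mathbf G_p$ for every $p\in S$, and $\mathbf F_{\{l,l'\}}=\mathbf G_{\{l,l'\}}$ for all distinct $l,l'\in N$; 3. for all distinct $p,q\in S$, $\mathbf X_p$ and $\mathbf X_q$ are independent, and $\mathbf Y_p$ and $\mathbf Y_q$ are independent; 4. for all $p\in S$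 and $l\in N$, $\mathbf X_p$ and $X_l$ are independent, and $\mathbf Y_p$ and $Y_l$ are independent. Then $$\max_{P\in\mathcal P}\mathcal E(P)=\sum_{p\in S}\mathcal E_p=\sum_{k=1}^{s}\mathcal E_{\{i_k,j_k\}},$$ and a perfect pairing $P\in\mathcal P$ attains the maximum if and only if $S\subseteq P$. -/

import Mathlib

open MeasureTheory ProbabilityTheory
open scoped ContDiff

noncomputable section

/-- `f` is completely monotone on the open half-line `(0, ∞)`: it is smooth there and
`(-1)ⁿ f⁽ⁿ⁾ ≥ 0` for every `n`. -/
def CompletelyMonotone (f : ℝ → ℝ) : Prop :=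
  ContDiffOn ℝ ∞ f (Set.Ioi 0) ∧
    ∀ (n : ℕ) (t : ℝ), 0 < t → 0 ≤ (-1 : ℝ) ^ n * iteratedDeriv n f t

/-- The functions `γ : [0, ∞) → [0, ∞)` that generate energy distances: continuous, increasing,
zero at zero, with a non-constant completely monotone derivative on `(0, ∞)`.
(Only the values of `γ` on `[0, ∞)` are ever used; nonnegativity follows from
monotonicity and `γ 0 = 0`.) -/
structure IsEnergyGenerator (γ : ℝ → ℝ) : Prop where
  continuousOn : ContinuousOn γ (Set.Ici 0)
  monotoneOn : MonotoneOn γ (Set.Ici 0)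
  map_zero : γ 0 = 0
  differentiableOn : DifferentiableOn ℝ γ (Set.Ioi 0)
  completelyMonotone_deriv : CompletelyMonotone (deriv γ)
  deriv_nonconstant : ¬ ∃ c : ℝ, ∀ t : ℝ, 0 < t → deriv γ t = c

section Energy

variable {E : Type*} [NormedAddCommGroup E] [MeasurableSpace E]

/-- `E[γ(‖U - V‖² / 2)]` for independent `U ∼ μ` and `V ∼ ν`. -/
def meanGap (γ : ℝ → ℝ) (μ ν : Measure E) : ℝ :=
  ∫ p : E × E, γ (‖p.1 - p.2‖ ^ 2 / 2) ∂(μ.prod ν)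

/-- The expectation `E[γ(‖U - V‖² / 2)]` for independent `U ∼ μ` and `V ∼ ν` is finite. -/
def MeanGapFinite (γ : ℝ → ℝ) (μ ν : Measure E) : Prop :=
  Integrable (fun p : E × E => γ (‖p.1 - p.2‖ ^ 2 / 2)) (μ.prod ν)

/-- The energy distance `2 E[γ(‖X₁ - Y₁‖²/2)] - E[γ(‖X₁ - X₂‖²/2)] - E[γ(‖Y₁ - Y₂‖²/2)]`, where
`X₁, X₂ ∼ μ` and `Y₁, Y₂ ∼ ν` are independent. -/
def energyDist (γ : ℝ → ℝ) (μ ν : Measure E) : ℝ :=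
  2 * meanGap γ μ ν - meanGap γ μ μ - meanGap γ ν ν

/-- All three expectations in the energy distance are finite. -/
def EnergyFinite (γ : ℝ → ℝ) (μ ν : Measure E) : Prop :=
  MeanGapFinite γ μ ν ∧ MeanGapFinite γ μ μ ∧ MeanGapFinite γ ν ν

end Energy

section Pairs

variable {d : ℕ}

/-- The subvector `x_p = (x_k)_{k ∈ p}` of `x ∈ ℝᵈ`, an element of the Euclidean space `ℝᵖ`. -/
def subvector (p : Finset (Fin d)) (x : Fin d → ℝ) : EuclideanSpace ℝ p :=
  WithLp.toLp 2 fun k => x k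

/-- The joint distribution of the coordinates in `p` of a random vector with distribution `F`. -/
def jointLaw (F : Measure (Fin d → ℝ)) (p : Finset (Fin d)) : Measure (EuclideanSpace ℝ p) :=
  F.map (subvector p)

/-- The distribution of the `k`-th coordinate of a random vector with distribution `F`. -/
def marginalLaw (F : Measure (Fin d → ℝ)) (k : Fin d) : Measure ℝ :=
  F.map fun x => x k

/-- The energy distance between the joint distributions of the coordinates in the pair `p`. -/
def pairEnergy (γ : ℝ → ℝ) (F G : Measure (Fin d → ℝ)) (p : Finset (Fin d)) : ℝ :=
  energyDist γ (jointLaw F p) (jointLaw G p)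

/-- A perfect pairing: a partition of the set of all coordinates into two-element blocks. -/
def PerfectPairing (d : ℕ) : Type :=
  {P : Finpartition (Finset.univ : Finset (Fin d)) // ∀ p ∈ P.parts, p.card = 2}

/-- The set of pairs of a perfect pairing. -/
def PerfectPairing.pairs (P : PerfectPairing d) : Finset (Finset (Fin d)) :=
  P.1.parts

/-- The total pair energy of a perfect pairing. -/
def totalEnergy (γ : ℝ → ℝ) (F G : Measure (Fin d → ℝ)) (P : PerfectPairing d) : ℝ :=
  ∑ p ∈ P.pairs, pairEnergy γ F G p

/-- The set of pairs `{i₁, j₁}, …, {iₛ, jₛ}`. -/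
def signalPairs {s : ℕ} (i j : Fin s → Fin d) : Finset (Finset (Fin d)) :=
  Finset.univ.image fun k => {i k, j k}

/-- The coordinates outside `{i₁, …, iₛ, j₁, …, jₛ}`. -/
def noiseCoords {s : ℕ} (i j : Fin s → Fin d) : Set (Fin d) :=
  (Set.range i ∪ Set.range j)ᶜ

/-- Under `H`, the subvectors of any two different signal pairs are independent, and the
subvector of any signal pair is independent of any noise coordinate. -/
structure SignalIndependence {s : ℕ} (i j : Fin s → Fin d) (H : Measure (Fin d → ℝ)) :
    Prop where
  signal_signal : ∀ p ∈ signalPairs i j, ∀ q ∈ signalPairs i j, p ≠ q →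
    IndepFun (subvector p) (subvector q) H
  signal_noise : ∀ p ∈ signalPairs i j, ∀ l ∈ noiseCoords i j,
    IndepFun (subvector p) (fun x => x l) H

/-- The paired-signal setting: the indices `i₁, …, iₛ, j₁, …, jₛ` are distinct, all marginals
of `F` and `G` agree, the joint distributions of every signal pair differ, and the joint
distributions of any two noise coordinates agree. -/
structure PairedSignalSetting {s : ℕ} (i j : Fin s → Fin d) (F G : Measure (Fin d → ℝ)) :
    Prop where
  distinct : Function.Injective (Sum.elim i j)
  marginal_eq : ∀ k, marginalLaw F k = marginalLaw G k
  signal_ne : ∀ p ∈ signalPairs i j, jointLaw F p ≠ jointLaw G p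
  noise_eq : ∀ l ∈ noiseCoords i j, ∀ l' ∈ noiseCoords i j, l ≠ l' →
    jointLaw F {l, l'} = jointLaw G {l, l'}

end Pairs

end

/-!
For the kernels `t ↦ exp (-l t)` the energy distance is, up to sign, the squared `L²` distance of
the characteristic functions of the two laws with respect to a Gaussian weight, so it is nonpositive
and, for `l > 0`, vanishes only if the laws agree. By Bernstein's theorem the same holds for every
nonconstant completely monotone kernel that is continuous at `0`, such a kernel being a mixture of
exponentials. (To find the mixture, expand `f` in its Taylor series at `1 / h` and evaluate it at
`(1 - exp (-h t)) / h`: the `n`-th term is its value at `t = 0` times `exp (-n h t)`. Then let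
`h → 0`.)

The increment `t ↦ γ (t + b) - γ (t + a)` of an energy generator is completely monotone, so the
energy distance of `t ↦ γ (t + a) - γ a` decreases with `a`, from that of `γ` at `a = 0` to that of
a linear function with nonnegative slope as `a → ∞`. The latter is nonnegative, because a linear
function is a limit of functions `(1 - exp (-h t)) / h`, and the decrease is strict somewhere if the
laws differ. Hence a signal pair has positive energy. The two coordinates of any other pair are
either noise or independent, so that pair has energy `0`, and the total energy of a pairing is the
energy of the signal pairs in it.
-/

section EnergyCalculus

open Filter Topology

variable {E : Type*} [NormedAddCommGroup E] [MeasurableSpace E] {μ ν : Measure E} {f g : ℝ → ℝ}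

theorem EnergyFinite.const [IsFiniteMeasure μ] [IsFiniteMeasure ν] (c : ℝ) :
    EnergyFinite (fun _ => c) μ ν :=
  ⟨integrable_const _, integrable_const _, integrable_const _⟩

theorem EnergyFinite.sub (hf : EnergyFinite f μ ν) (hg : EnergyFinite g μ ν) :
    EnergyFinite (fun t => f t - g t) μ ν :=
  ⟨hf.1.sub hg.1, hf.2.1.sub hg.2.1, hf.2.2.sub hg.2.2⟩

theorem energyDist_self (f : ℝ → ℝ) (μ : Measure E) : energyDist f μ μ = 0 := by
  unfold energyDist
  ring

theorem energyDist_const [IsProbabilityMeasure μ] [IsProbabilityMeasure ν] (c : ℝ) :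
    energyDist (fun _ => c) μ ν = 0 := by
  simp only [energyDist, meanGap, integral_const, probReal_univ, one_smul]
  ring

theorem energyDist_const_mul (c : ℝ) (f : ℝ → ℝ) (μ ν : Measure E) :
    energyDist (fun t => c * f t) μ ν = c * energyDist f μ ν := by
  simp only [energyDist, meanGap, integral_const_mul]
  ring

theorem energyDist_sub (hf : EnergyFinite f μ ν) (hg : EnergyFinite g μ ν) :
    energyDist (fun t => f t - g t) μ ν = energyDist f μ ν - energyDist g μ ν := by
  simp only [energyDist, meanGap]
  rw [integral_sub hf.1 hg.1, integral_sub hf.2.1 hg.2.1, integral_sub hf.2.2 hg.2.2]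
  ring

theorem energyDist_congr (h : ∀ t, 0 ≤ t → f t = g t) (μ ν : Measure E) :
    energyDist f μ ν = energyDist g μ ν := by
  simp only [energyDist, meanGap, h _ (show 0 ≤ ‖_‖ ^ 2 / 2 by positivity)]

variable [OpensMeasurableSpace E] [SecondCountableTopology E]

theorem aestronglyMeasurable_comp_gap (hf : ContinuousOn f (Set.Ici 0)) :
    AEStronglyMeasurable (fun p : E × E => f (‖p.1 - p.2‖ ^ 2 / 2)) (μ.prod ν) :=
  (hf.comp_continuous (by fun_prop) fun p =>
    Set.mem_Ici.mpr (by positivity)).aestronglyMeasurable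

theorem EnergyFinite.mono (hg : EnergyFinite g μ ν) (hf : ContinuousOn f (Set.Ici 0))
    (hle : ∀ t, 0 ≤ t → |f t| ≤ g t) : EnergyFinite f μ ν := by
  have dominated {μ ν : Measure E} (h : MeanGapFinite g μ ν) : MeanGapFinite f μ ν :=
    Integrable.mono' h (aestronglyMeasurable_comp_gap hf)
      (ae_of_all _ fun p => hle _ (by positivity))
  exact ⟨dominated hg.1, dominated hg.2.1, dominated hg.2.2⟩

theorem tendsto_energyDist {ι : Type*} {l : Filter ι} [l.IsCountablyGenerated] {F : ι → ℝ → ℝ}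
    (hF : ∀ᶠ n in l, ContinuousOn (F n) (Set.Ici 0)) (hg : EnergyFinite g μ ν)
    (hle : ∀ᶠ n in l, ∀ t, 0 ≤ t → |F n t| ≤ g t)
    (hlim : ∀ t, 0 ≤ t → Tendsto (fun n => F n t) l (𝓝 (f t))) :
    Tendsto (fun n => energyDist (F n) μ ν) l (𝓝 (energyDist f μ ν)) := by
  have dominated {μ ν : Measure E} (h : MeanGapFinite g μ ν) :
      Tendsto (fun n => meanGap (F n) μ ν) l (𝓝 (meanGap f μ ν)) :=
    tendsto_integral_filter_of_dominated_convergence _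
      (hF.mono fun n hn => aestronglyMeasurable_comp_gap hn)
      (hle.mono fun n hn => ae_of_all _ fun p => hn _ (by positivity)) h
      (ae_of_all _ fun p => hlim _ (by positivity))
  exact (((dominated hg.1).const_mul 2).sub (dominated hg.2.1)).sub (dominated hg.2.2)

end EnergyCalculus

section GaussianKernel

open scoped ComplexConjugate RealInnerProductSpace

section CharFun

variable {E : Type*} [NormedAddCommGroup E] [InnerProductSpace ℝ E] [MeasurableSpace E]
  [BorelSpace E] [SecondCountableTopology E]

theorem integral_charFun_comm (μ ν : Measure E) [IsFiniteMeasure μ] [IsFiniteMeasure ν] :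
    ∫ x, charFun μ x ∂ν = ∫ y, charFun ν y ∂μ := by
  simp only [charFun_apply]
  rw [integral_integral_swap]
  · simp only [real_inner_comm]
  · refine (integrable_const (1 : ℝ)).mono' ?_ (ae_of_all _ fun p => ?_)
    · exact Continuous.aestronglyMeasurable (by fun_prop)
    · exact (Complex.norm_exp_ofReal_mul_I _).le

theorem charFun_map_smul_sub (μ ν : Measure E) [SFinite μ] [SFinite ν] (r : ℝ) (v : E) :
    charFun ((μ.prod ν).map fun p => r • (p.2 - p.1)) v =
      charFun ν (r • v) * conj (charFun μ (r • v)) := by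
  have exp_split (p : E × E) : Complex.exp (⟪r • (p.2 - p.1), v⟫ * Complex.I) =
      Complex.exp (⟪p.1, -(r • v)⟫ * Complex.I) * Complex.exp (⟪p.2, r • v⟫ * Complex.I) := by
    rw [← Complex.exp_add, ← add_mul, ← Complex.ofReal_add, inner_neg_right, real_inner_smul_left,
      inner_sub_left, real_inner_smul_right, real_inner_smul_right, mul_sub, sub_eq_neg_add]
  rw [mul_comm, ← charFun_neg, charFun_apply, integral_map (by fun_prop) (by fun_prop)]
  simp only [exp_split]
  exact integral_prod_mul (μ := μ) (ν := ν) (fun x => Complex.exp (⟪x, -(r • v)⟫ * Complex.I))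
    fun y => Complex.exp (⟪y, r • v⟫ * Complex.I)

end CharFun

variable {E : Type*} [NormedAddCommGroup E] [InnerProductSpace ℝ E] [FiniteDimensional ℝ E]
  [MeasurableSpace E] [BorelSpace E]

theorem exp_neg_mul_sq_norm_eq_charFun_stdGaussian {l : ℝ} (hl : 0 ≤ l) (x : E) :
    (Real.exp (-(l * (‖x‖ ^ 2 / 2))) : ℂ) = charFun (stdGaussian E) (√l • x) := by
  rw [charFun_stdGaussian, norm_smul, Real.norm_of_nonneg (Real.sqrt_nonneg l)]
  norm_cast
  rw [mul_pow, Real.sq_sqrt hl]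
  ring_nf

variable (μ ν : Measure E)

theorem integrable_charFun_mul_conj_charFun [IsFiniteMeasure μ] [IsFiniteMeasure ν] (r : ℝ)
    (σ : Measure E) [IsFiniteMeasure σ] :
    Integrable (fun v => charFun ν (r • v) * conj (charFun μ (r • v))) σ := by
  refine (integrable_const (ν.real Set.univ * μ.real Set.univ)).mono'
    (Continuous.aestronglyMeasurable (by fun_prop)) (ae_of_all _ fun v => ?_)
  rw [norm_mul, RCLike.norm_conj]
  gcongr <;> exact norm_charFun_le _

theorem meanGap_exp_eq_integral_inner_charFun [IsFiniteMeasure μ] [IsFiniteMeasure ν] {l : ℝ}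
    (hl : 0 ≤ l) : meanGap (fun t => Real.exp (-(l * t))) μ ν =
      ∫ v, ⟪charFun μ (√l • v), charFun ν (√l • v)⟫ ∂stdGaussian E := by
  have parseval : (meanGap (fun t => Real.exp (-(l * t))) μ ν : ℂ) =
      ∫ v, charFun ν (√l • v) * conj (charFun μ (√l • v)) ∂stdGaussian E := by
    simp only [meanGap, ← integral_complex_ofReal, norm_sub_rev (Prod.fst _),
      exp_neg_mul_sq_norm_eq_charFun_stdGaussian hl, ← charFun_map_smul_sub]
    rw [integral_charFun_comm, integral_map (by fun_prop) (by fun_prop)]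
  simp only [Complex.inner]
  rw [← Complex.ofReal_re (meanGap _ _ _), parseval]
  exact (integral_re (integrable_charFun_mul_conj_charFun μ ν √l (stdGaussian E))).symm

theorem energyDist_exp_eq_neg_integral [IsFiniteMeasure μ] [IsFiniteMeasure ν] {l : ℝ}
    (hl : 0 ≤ l) : energyDist (fun t => Real.exp (-(l * t))) μ ν =
      -∫ v, ‖charFun μ (√l • v) - charFun ν (√l • v)‖ ^ 2 ∂stdGaussian E := by
  have integrable_inner (μ ν : Measure E) [IsFiniteMeasure μ] [IsFiniteMeasure ν] :
      Integrable (fun v => ⟪charFun μ (√l • v), charFun ν (√l • v)⟫) (stdGaussian E) := by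
    simpa only [Complex.inner, RCLike.re_eq_complex_re] using
      (integrable_charFun_mul_conj_charFun μ ν √l (stdGaussian E)).re
  have expand (z w : ℂ) : ‖z - w‖ ^ 2 = ⟪z, z⟫ - 2 * ⟪z, w⟫ + ⟪w, w⟫ := by
    rw [norm_sub_sq_real, real_inner_self_eq_norm_sq, real_inner_self_eq_norm_sq]
  simp only [expand, energyDist, meanGap_exp_eq_integral_inner_charFun _ _ hl]
  rw [integral_add ((integrable_inner μ μ).sub' ((integrable_inner μ ν).const_mul 2))
      (integrable_inner ν ν),
    integral_sub (integrable_inner μ μ) ((integrable_inner μ ν).const_mul 2), integral_const_mul]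
  ring

theorem energyDist_exp_nonpos [IsFiniteMeasure μ] [IsFiniteMeasure ν] {l : ℝ} (hl : 0 ≤ l) :
    energyDist (fun t => Real.exp (-(l * t))) μ ν ≤ 0 := by
  rw [energyDist_exp_eq_neg_integral μ ν hl, neg_nonpos]
  positivity

theorem isOpenPosMeasure_stdGaussian : (stdGaussian E).IsOpenPosMeasure := by
  have : (gaussianReal 0 1).IsOpenPosMeasure :=
    (gaussianReal_absolutelyContinuous' 0 one_ne_zero).isOpenPosMeasure
  exact Continuous.isOpenPosMeasure_map (by fun_prop)
    fun x => ⟨fun i => (stdOrthonormalBasis ℝ E).repr x i, (stdOrthonormalBasis ℝ E).sum_repr x⟩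

variable {μ ν} in
theorem energyDist_exp_neg [IsFiniteMeasure μ] [IsFiniteMeasure ν] (hne : μ ≠ ν) {l : ℝ}
    (hl : 0 < l) : energyDist (fun t => Real.exp (-(l * t))) μ ν < 0 := by
  have := isOpenPosMeasure_stdGaussian (E := E)
  obtain ⟨w, hw⟩ : ∃ w, charFun μ w ≠ charFun ν w := by
    by_contra! h
    exact hne (Measure.ext_of_charFun (funext h))
  rw [energyDist_exp_eq_neg_integral μ ν hl.le, neg_lt_zero]
  refine integral_pos_of_integrable_nonneg_nonzero (x := (√l)⁻¹ • w) (by fun_prop) ?_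
    (fun v => by positivity) ?_
  · refine (integrable_const ((μ.real Set.univ + ν.real Set.univ) ^ 2)).mono' (by fun_prop)
      (ae_of_all _ fun v => ?_)
    rw [norm_pow, norm_norm]
    gcongr
    exact (norm_sub_le _ _).trans (add_le_add (norm_charFun_le _) (norm_charFun_le _))
  · rw [smul_inv_smul₀ (Real.sqrt_pos.mpr hl).ne']
    exact pow_ne_zero 2 (norm_ne_zero_iff.mpr (sub_ne_zero.mpr hw))

end GaussianKernel

namespace CompletelyMonotone

open Filter Topology

theorem of_neg_deriv {g : ℝ → ℝ} (hd : DifferentiableOn ℝ g (Set.Ioi 0))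
    (h0 : ∀ t, 0 < t → 0 ≤ g t) (h : CompletelyMonotone (fun t => -deriv g t)) :
    CompletelyMonotone g := by
  refine ⟨?_, fun n t ht => ?_⟩
  · rw [contDiffOn_infty_iff_deriv_of_isOpen isOpen_Ioi]
    refine ⟨hd, ?_⟩
    simpa using h.1.neg
  · cases n with
    | zero => simpa using h0 t ht
    | succ n =>
      have := h.2 n t ht
      rw [iteratedDeriv_fun_neg] at this
      rw [iteratedDeriv_succ', pow_succ]
      linarith

variable {f : ℝ → ℝ} (hf : CompletelyMonotone f)
include hf

theorem nonneg {t : ℝ} (ht : 0 < t) : 0 ≤ f t := by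
  simpa using hf.2 0 t ht

theorem contDiffAt {t : ℝ} (ht : 0 < t) : ContDiffAt ℝ ∞ f t :=
  hf.1.contDiffAt (Ioi_mem_nhds ht)

theorem congr {g : ℝ → ℝ} (h : Set.EqOn g f (Set.Ioi 0)) : CompletelyMonotone g := by
  refine ⟨hf.1.congr h, fun n t ht => ?_⟩
  rw [h.iteratedDeriv_of_isOpen isOpen_Ioi n ht]
  exact hf.2 n t ht

theorem contDiffOn_iteratedDeriv (n : ℕ) : ContDiffOn ℝ ∞ (iteratedDeriv n f) (Set.Ioi 0) := by
  induction n with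
  | zero => simpa using hf.1
  | succ n ih =>
    rw [iteratedDeriv_succ]
    exact ((contDiffOn_infty_iff_deriv_of_isOpen isOpen_Ioi).mp ih).2

theorem antitoneOn_iteratedDeriv (n : ℕ) :
    AntitoneOn (fun t => (-1 : ℝ) ^ n * iteratedDeriv n f t) (Set.Ioi 0) := by
  have hd : DifferentiableOn ℝ (fun t => (-1 : ℝ) ^ n * iteratedDeriv n f t) (Set.Ioi 0) :=
    ((hf.contDiffOn_iteratedDeriv n).differentiableOn (by simp)).const_mul _
  refine antitoneOn_of_deriv_nonpos (convex_Ioi 0) hd.continuousOn ?_ fun t ht => ?_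
  · rwa [interior_Ioi]
  · rw [interior_Ioi] at ht
    rw [deriv_const_mul_field, ← iteratedDeriv_succ]
    have := hf.2 (n + 1) t ht
    rw [pow_succ] at this
    linarith

theorem antitoneOn : AntitoneOn f (Set.Ioi 0) := by
  simpa using hf.antitoneOn_iteratedDeriv 0

theorem antitoneOn_Ici (hc : ContinuousOn f (Set.Ici 0)) : AntitoneOn f (Set.Ici 0) := by
  refine antitoneOn_of_deriv_nonpos (convex_Ici 0) hc ?_ fun t ht => ?_
  · rw [interior_Ici]
    exact hf.1.differentiableOn (by simp)
  · rw [interior_Ici] at ht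
    have := hf.2 1 t ht
    rw [iteratedDeriv_one] at this
    linarith

theorem comp_add {h : ℝ} (hh : 0 ≤ h) : CompletelyMonotone (fun t => f (t + h)) := by
  refine ⟨hf.1.comp (by fun_prop) fun t ht => ?_, fun n t ht => ?_⟩
  · exact lt_of_lt_of_le (Set.mem_Ioi.mp ht) (by linarith)
  · rw [iteratedDeriv_comp_add_const]
    exact hf.2 n _ (by linarith)

theorem sub_comp_add {h : ℝ} (hh : 0 ≤ h) : CompletelyMonotone (fun t => f t - f (t + h)) := by
  have hs := hf.comp_add hh
  refine ⟨hf.1.sub hs.1, fun n t ht => ?_⟩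
  have difference : iteratedDeriv n (fun t => f t - f (t + h)) t =
      iteratedDeriv n f t - iteratedDeriv n f (t + h) := by
    have := iteratedDeriv_sub (n := n) (x := t)
      ((hf.contDiffAt ht).of_le (by exact_mod_cast le_top))
      ((hs.contDiffAt ht).of_le (by exact_mod_cast le_top))
    rw [iteratedDeriv_comp_add_const] at this
    exact this
  rw [difference, mul_sub, sub_nonneg]
  exact hf.antitoneOn_iteratedDeriv n (Set.mem_Ioi.mpr ht) (Set.mem_Ioi.mpr (by linarith))
    (by linarith)

theorem exists_tendsto_atTop : ∃ c, 0 ≤ c ∧ Tendsto f atTop (𝓝 c) := by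
  have hpos (x : ℝ) : 0 < max x 1 := lt_max_of_lt_right one_pos
  have hanti : Antitone fun x => f (max x 1) := fun x y hxy =>
    hf.antitoneOn (hpos x) (hpos y) (max_le_max_right 1 hxy)
  have hbdd : BddBelow (Set.range fun x => f (max x 1)) :=
    ⟨0, Set.forall_mem_range.mpr fun x => hf.nonneg (hpos x)⟩
  refine ⟨_, le_ciInf fun x => hf.nonneg (hpos x), (tendsto_atTop_ciInf hanti hbdd).congr' ?_⟩
  filter_upwards [eventually_ge_atTop 1] with x hx
  rw [max_eq_left hx]

end CompletelyMonotone

section TaylorExpansion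

open Filter Topology
open scoped Nat

/-- The remainder `f x - ∑_{k ≤ n} f⁽ᵏ⁾(a) (x - a)ᵏ / k!` of the Taylor polynomial of degree `n`
of `f` at `a`, formed with the two-sided derivatives of `f`. -/
noncomputable def taylorRemainder (f : ℝ → ℝ) (n : ℕ) (a x : ℝ) : ℝ :=
  f x - ∑ k ∈ Finset.range (n + 1), iteratedDeriv k f a / k ! * (x - a) ^ k

namespace CompletelyMonotone

variable {f : ℝ → ℝ} (hf : CompletelyMonotone f)
include hf

theorem taylorRemainder_eq_integral {a x : ℝ} (hx : 0 < x) (hxa : x ≤ a) (n : ℕ) :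
    taylorRemainder f n a x =
      ∫ t in x..a, (t - x) ^ n / n ! * ((-1) ^ (n + 1) * iteratedDeriv (n + 1) f t) := by
  rcases hxa.eq_or_lt with rfl | hlt
  · simp [taylorRemainder, Finset.sum_range_succ']
  have hsub : Set.uIcc a x ⊆ Set.Ioi 0 := by
    rw [Set.uIcc_of_ge hxa]
    exact fun t ht => hx.trans_le ht.1
  have within (k : ℕ) {t : ℝ} (ht : t ∈ Set.uIcc a x) :
      iteratedDerivWithin k f (Set.uIcc a x) t = iteratedDeriv k f t :=
    iteratedDerivWithin_eq_iteratedDeriv (uniqueDiffOn_uIcc hlt.ne')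
      ((hf.contDiffAt (hsub ht)).of_le (by exact_mod_cast le_top)) ht
  have taylor := taylor_integral_remainder (n := n)
    ((hf.1.mono hsub).of_le (by exact_mod_cast le_top))
  rw [taylor_within_apply] at taylor
  calc taylorRemainder f n a x
      = ∫ t in a..x, ((x - t) ^ n / n !) • iteratedDerivWithin (n + 1) f (Set.uIcc a x) t := by
        rw [← taylor, taylorRemainder]
        congr 1
        refine Finset.sum_congr rfl fun k _ => ?_
        rw [within k Set.left_mem_uIcc, smul_eq_mul]
        ring
    _ = ∫ t in x..a, (t - x) ^ n / n ! * ((-1) ^ (n + 1) * iteratedDeriv (n + 1) f t) := by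
        rw [intervalIntegral.integral_symm, ← intervalIntegral.integral_neg]
        refine intervalIntegral.integral_congr fun t ht => ?_
        simp only [within (n + 1) (Set.uIcc_comm x a ▸ ht), smul_eq_mul]
        rw [← neg_sub t x, neg_pow, pow_succ]
        ring

theorem taylor_term_nonneg {a x : ℝ} (ha : 0 < a) (hxa : x ≤ a) (n : ℕ) :
    0 ≤ iteratedDeriv n f a / n ! * (x - a) ^ n := by
  have alternate_signs : iteratedDeriv n f a / n ! * (x - a) ^ n =
      (-1) ^ n * iteratedDeriv n f a * ((a - x) ^ n / n !) := by
    rw [← neg_sub a x, neg_pow]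
    ring
  rw [alternate_signs]
  exact mul_nonneg (hf.2 n a ha) (div_nonneg (pow_nonneg (sub_nonneg.mpr hxa) n) (by positivity))

theorem taylorRemainder_le {a x : ℝ} (ha : 0 < a) (hxa : x ≤ a) (n : ℕ) :
    taylorRemainder f n a x ≤ f x :=
  sub_le_self _ (Finset.sum_nonneg fun k _ => hf.taylor_term_nonneg ha hxa k)

theorem taylorRemainder_nonneg {a x : ℝ} (hx : 0 < x) (hxa : x ≤ a) (n : ℕ) :
    0 ≤ taylorRemainder f n a x := by
  rw [hf.taylorRemainder_eq_integral hx hxa]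
  exact intervalIntegral.integral_nonneg hxa fun t ht =>
    mul_nonneg (div_nonneg (pow_nonneg (sub_nonneg.mpr ht.1) n) (by positivity))
      (hf.2 (n + 1) t (hx.trans_le ht.1))

theorem intervalIntegrable_taylor {b x a : ℝ} (hx : 0 < x) (hxa : x ≤ a) (n : ℕ) :
    IntervalIntegrable
      (fun t => (t - b) ^ n / n ! * ((-1) ^ (n + 1) * iteratedDeriv (n + 1) f t)) volume x a := by
  refine ContinuousOn.intervalIntegrable (ContinuousOn.mul (by fun_prop)
    (continuousOn_const.mul ((hf.contDiffOn_iteratedDeriv (n + 1)).continuousOn.mono ?_)))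
  rw [Set.uIcc_of_le hxa]
  exact fun t ht => hx.trans_le ht.1

theorem taylorRemainder_le_pow_mul {a x y : ℝ} (hy : 0 < y) (hyx : y < x) (hxa : x ≤ a) (n : ℕ) :
    taylorRemainder f n a x ≤ ((a - x) / (a - y)) ^ n * taylorRemainder f n a y := by
  have hx := hy.trans hyx
  have hya := hyx.trans_le hxa
  set D : ℝ → ℝ := fun t => (-1) ^ (n + 1) * iteratedDeriv (n + 1) f t
  set q := (a - x) / (a - y)
  have hq : 0 ≤ q := div_nonneg (by linarith) (by linarith)
  have hint {b c : ℝ} (hc : 0 < c) (hca : c ≤ a) :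
      IntervalIntegrable (fun t => (t - b) ^ n / n ! * D t) volume c a :=
    hf.intervalIntegrable_taylor hc hca n
  have contraction {t : ℝ} (ht : t ∈ Set.Icc x a) : t - x ≤ q * (t - y) := by
    rw [div_mul_eq_mul_div, le_div_iff₀ (by linarith)]
    nlinarith [mul_nonneg (sub_nonneg.mpr ht.2) (sub_nonneg.mpr hyx.le)]
  rw [hf.taylorRemainder_eq_integral hx hxa, hf.taylorRemainder_eq_integral hy hya.le]
  calc ∫ t in x..a, (t - x) ^ n / n ! * D t
      ≤ ∫ t in x..a, q ^ n * ((t - y) ^ n / n ! * D t) := by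
        refine intervalIntegral.integral_mono_on hxa (hint hx hxa) ((hint hx hxa).const_mul _)
          fun t ht => ?_
        have hD : 0 ≤ D t := hf.2 (n + 1) t (hx.trans_le ht.1)
        refine (mul_le_mul_of_nonneg_right ?_ hD).trans_eq (mul_assoc _ _ _)
        rw [← mul_div_assoc, ← mul_pow]
        gcongr
        · exact sub_nonneg.mpr ht.1
        · exact contraction ht
    _ = q ^ n * ∫ t in x..a, (t - y) ^ n / n ! * D t := intervalIntegral.integral_const_mul _ _
    _ ≤ q ^ n * ∫ t in y..a, (t - y) ^ n / n ! * D t := by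
        refine mul_le_mul_of_nonneg_left ?_ (pow_nonneg hq n)
        refine intervalIntegral.integral_mono_interval hyx.le hxa le_rfl ?_ (hint hy hya.le)
        filter_upwards [ae_restrict_mem measurableSet_Ioc] with t ht
        exact mul_nonneg (div_nonneg (pow_nonneg (sub_nonneg.mpr ht.1.le) n) (by positivity))
          (hf.2 (n + 1) t (hy.trans ht.1))

theorem hasSum_taylor {a x : ℝ} (hx : 0 < x) (hxa : x ≤ a) :
    HasSum (fun n => iteratedDeriv n f a / n ! * (x - a) ^ n) (f x) := by
  have ha := hx.trans_le hxa
  rw [hasSum_iff_tendsto_nat_of_nonneg (hf.taylor_term_nonneg ha hxa),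
    ← tendsto_add_atTop_iff_nat 1]
  set q := (a - x) / (a - x / 2)
  have hq : 0 ≤ q := div_nonneg (by linarith) (by linarith)
  have hq1 : q < 1 := (div_lt_one (by linarith)).mpr (by linarith)
  have geometric (n : ℕ) : taylorRemainder f n a x ≤ q ^ n * f (x / 2) :=
    (hf.taylorRemainder_le_pow_mul (half_pos hx) (half_lt_self hx) hxa n).trans
      (by gcongr; exact hf.taylorRemainder_le ha (by linarith) n)
  have vanish : Tendsto (fun n => taylorRemainder f n a x) atTop (𝓝 0) :=
    squeeze_zero (hf.taylorRemainder_nonneg hx hxa) geometric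
      (by simpa using (tendsto_pow_atTop_nhds_zero_of_lt_one hq hq1).mul_const (f (x / 2)))
  simpa [taylorRemainder] using vanish.const_sub (f x)

theorem sum_taylor_zero_le (hc : ContinuousOn f (Set.Ici 0)) {a : ℝ} (ha : 0 < a) (N : ℕ) :
    ∑ n ∈ Finset.range N, iteratedDeriv n f a / n ! * (0 - a) ^ n ≤ f 0 := by
  have hlim : Tendsto (fun x => ∑ n ∈ Finset.range N, iteratedDeriv n f a / n ! * (x - a) ^ n)
      (𝓝[>] 0) (𝓝 (∑ n ∈ Finset.range N, iteratedDeriv n f a / n ! * (0 - a) ^ n)) :=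
    Continuous.continuousWithinAt (by fun_prop)
  refine le_of_tendsto hlim ?_
  filter_upwards [Ioc_mem_nhdsGT ha] with x ⟨hx, hxa⟩
  calc ∑ n ∈ Finset.range N, iteratedDeriv n f a / n ! * (x - a) ^ n
      ≤ f x := sum_le_hasSum _ (fun n _ => hf.taylor_term_nonneg ha hxa n) (hf.hasSum_taylor hx hxa)
    _ ≤ f 0 := hf.antitoneOn_Ici hc Set.self_mem_Ici hx.le hx.le

end CompletelyMonotone

end TaylorExpansion

section BernsteinTheorem

open Filter Topology
open scoped Nat NNReal unitInterval

theorem tendsto_inv_mul_one_sub_exp (t : ℝ) :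
    Tendsto (fun h : ℝ => h⁻¹ * (1 - Real.exp (-(h * t)))) (𝓝[>] 0) (𝓝 t) := by
  have hderiv : HasDerivAt (fun h : ℝ => 1 - Real.exp (-(h * t))) t 0 := by
    simpa using ((hasDerivAt_id (0 : ℝ)).mul_const t).neg.exp.const_sub 1
  simpa using hderiv.tendsto_slope_zero_right

theorem continuousOn_integral_exp (ρ : Measure ℝ≥0) [IsFiniteMeasure ρ] :
    ContinuousOn (fun t => ∫ l, Real.exp (-(l * t)) ∂ρ) (Set.Ici 0) := by
  refine continuousOn_of_dominated (bound := fun _ => 1)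
    (fun t _ => Continuous.aestronglyMeasurable (by fun_prop)) (fun t ht => ae_of_all _ fun l => ?_)
    (integrable_const 1) (ae_of_all _ fun l => by fun_prop)
  rw [Real.norm_of_nonneg (Real.exp_nonneg _), Real.exp_le_one_iff, neg_nonpos]
  exact mul_nonneg l.2 ht

namespace CompletelyMonotone

variable {f : ℝ → ℝ} (hf : CompletelyMonotone f)
include hf

theorem hasSum_taylor_zero_mul_exp {h t : ℝ} (hh : 0 < h) (ht : 0 < t) :
    HasSum (fun n : ℕ => iteratedDeriv n f h⁻¹ / n ! * (0 - h⁻¹) ^ n * Real.exp (-(n * h)) ^ t)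
      (f (h⁻¹ * (1 - Real.exp (-(h * t))))) := by
  have ha : 0 < h⁻¹ := inv_pos.mpr hh
  have hexp : Real.exp (-(h * t)) < 1 := by
    rw [Real.exp_lt_one_iff, neg_lt_zero]
    positivity
  have taylor := hf.hasSum_taylor (a := h⁻¹) (mul_pos ha (sub_pos.mpr hexp))
    (mul_le_of_le_one_right ha.le (sub_le_self 1 (Real.exp_nonneg _)))
  have displacement : h⁻¹ * (1 - Real.exp (-(h * t))) - h⁻¹ =
      (0 - h⁻¹) * Real.exp (-(h * t)) := by ring
  convert taylor using 2 with n
  rw [displacement, mul_pow, ← Real.exp_nat_mul, ← Real.exp_mul]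
  ring_nf

theorem exists_finiteMeasure_integral_rpow_eq (hc : ContinuousOn f (Set.Ici 0)) {h : ℝ}
    (hh : 0 < h) :
    ∃ ρ : FiniteMeasure I, ρ.mass ≤ (f 0).toNNReal ∧
      ∀ t, 0 < t → ∫ x : I, (x : ℝ) ^ t ∂ρ = f (h⁻¹ * (1 - Real.exp (-(h * t)))) := by
  have ha : 0 < h⁻¹ := inv_pos.mpr hh
  set w : ℕ → ℝ := fun n => iteratedDeriv n f h⁻¹ / n ! * (0 - h⁻¹) ^ n
  set node : ℕ → I := fun n =>
    ⟨Real.exp (-(n * h)), by positivity, Real.exp_le_one_iff.mpr (neg_nonpos.mpr (by positivity))⟩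
  have hw (n : ℕ) : 0 ≤ w n := hf.taylor_term_nonneg ha ha.le n
  have hsum : Summable w := summable_of_sum_range_le hw (hf.sum_taylor_zero_le hc ha)
  set ρ : Measure I := Measure.sum fun n => ENNReal.ofReal (w n) • Measure.dirac (node n)
  have mass : ρ Set.univ = ENNReal.ofReal (∑' n, w n) := by
    simp [ρ, ENNReal.ofReal_tsum_of_nonneg hw hsum]
  have finite : IsFiniteMeasure ρ := ⟨by simp [mass]⟩
  refine ⟨(⟨ρ, finite⟩ : FiniteMeasure I), ?_, fun t ht => ?_⟩
  · change (ρ Set.univ).toNNReal ≤ _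
    rw [mass]
    exact Real.toNNReal_le_toNNReal
      (Real.tsum_le_of_sum_range_le hw (hf.sum_taylor_zero_le hc ha))
  · refine (integral_sum_dirac fun n => ENNReal.ofReal_ne_top).trans ?_
    simp only [ENNReal.toReal_ofReal (hw _), smul_eq_mul]
    exact (hf.hasSum_taylor_zero_mul_exp hh ht).tsum_eq

theorem exists_finiteMeasure_eq_integral_rpow (hc : ContinuousOn f (Set.Ici 0)) :
    ∃ ρ : FiniteMeasure I, ∀ t, 0 < t → f t = ∫ x : I, (x : ℝ) ^ t ∂ρ := by
  choose ρ hmass hint using fun n : ℕ =>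
    hf.exists_finiteMeasure_integral_rpow_eq hc (Nat.one_div_pos_of_nat (α := ℝ) (n := n))
  obtain ⟨ρlim, -, hle⟩ := (isCompact_setOfPred_finiteMeasure_le_of_compactSpace I
    (f 0).toNNReal).ultrafilter_le_nhds' ((hyperfilter ℕ).map ρ)
    (Filter.mem_map.mpr (Filter.univ_mem' hmass))
  refine ⟨ρlim, fun t ht => ?_⟩
  have weak : Tendsto (fun n => ∫ x : I, (x : ℝ) ^ t ∂ρ n) (hyperfilter ℕ)
      (𝓝 (∫ x : I, (x : ℝ) ^ t ∂ρlim)) :=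
    FiniteMeasure.tendsto_iff_forall_integral_tendsto.mp hle
      (BoundedContinuousFunction.mkOfCompact
        ⟨fun x : I => (x : ℝ) ^ t, continuous_subtype_val.rpow_const fun _ => Or.inr ht.le⟩)
  have step : Tendsto (fun n : ℕ => 1 / ((n : ℝ) + 1)) atTop (𝓝[>] 0) :=
    tendsto_nhdsWithin_iff.mpr ⟨tendsto_one_div_add_atTop_nhds_zero_nat,
      Eventually.of_forall fun n => Set.mem_Ioi.mpr Nat.one_div_pos_of_nat⟩
  have pointwise : Tendsto (fun n => ∫ x : I, (x : ℝ) ^ t ∂ρ n) atTop (𝓝 (f t)) := by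
    simp only [hint _ t ht]
    exact (hf.contDiffAt ht).continuousAt.tendsto.comp ((tendsto_inv_mul_one_sub_exp t).comp step)
  exact tendsto_nhds_unique (pointwise.mono_left Nat.hyperfilter_le_atTop) weak

theorem exists_isFiniteMeasure_eq_integral_exp (hc : ContinuousOn f (Set.Ici 0)) :
    ∃ ρ : Measure ℝ≥0, IsFiniteMeasure ρ ∧ ∀ t, 0 ≤ t → f t = ∫ l, Real.exp (-(l * t)) ∂ρ := by
  obtain ⟨κ, hκ⟩ := hf.exists_finiteMeasure_eq_integral_rpow hc
  set ρ : Measure ℝ≥0 :=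
    ((κ : Measure I).restrict {0}ᶜ).map fun x : I => (-Real.log x).toNNReal
  have positive (t : ℝ) (ht : 0 < t) : f t = ∫ l, Real.exp (-(l * t)) ∂ρ := by
    rw [hκ t ht, integral_map (by fun_prop) (Continuous.aestronglyMeasurable (by fun_prop)),
      ← setIntegral_eq_integral_of_forall_compl_eq_zero (s := {0}ᶜ)]
    · refine setIntegral_congr_fun (measurableSet_singleton 0).compl fun x hx => ?_
      have hx0 : (0 : ℝ) < x := unitInterval.pos_iff_ne_zero.mpr hx
      have hlog : 0 ≤ -Real.log x := neg_nonneg.mpr (Real.log_nonpos hx0.le x.2.2)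
      simp only [Real.coe_toNNReal _ hlog, Real.rpow_def_of_pos hx0]
      ring_nf
    · intro x hx
      rw [Set.notMem_compl_iff, Set.mem_singleton_iff] at hx
      simp [hx, ht.ne']
  have on_Ioi : Set.EqOn f (fun t => ∫ l, Real.exp (-(l * t)) ∂ρ) (Set.Ioi 0) := positive
  refine ⟨ρ, inferInstance, on_Ioi.of_subset_closure hc (continuousOn_integral_exp ρ)
    Set.Ioi_subset_Ici_self (closure_Ioi (0 : ℝ)).ge⟩

end CompletelyMonotone

end BernsteinTheorem

section CompletelyMonotoneEnergy

open Filter Topology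
open scoped NNReal

variable {E : Type*} [NormedAddCommGroup E] [InnerProductSpace ℝ E] [FiniteDimensional ℝ E]
  [MeasurableSpace E] [BorelSpace E] {μ ν : Measure E} {f : ℝ → ℝ}

theorem integrable_exp_neg_mul_sq_norm_sub [IsFiniteMeasure μ] [IsFiniteMeasure ν]
    (ρ : Measure ℝ≥0) [IsFiniteMeasure ρ] :
    Integrable (fun q : ℝ≥0 × E × E => Real.exp (-(q.1 * (‖q.2.1 - q.2.2‖ ^ 2 / 2))))
      (ρ.prod (μ.prod ν)) := by
  refine (integrable_const (1 : ℝ)).mono' (Continuous.aestronglyMeasurable (by fun_prop))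
    (ae_of_all _ fun q => ?_)
  rw [Real.norm_of_nonneg (Real.exp_nonneg _), Real.exp_le_one_iff, neg_nonpos]
  positivity

theorem integrable_energyDist_exp [IsFiniteMeasure μ] [IsFiniteMeasure ν] (ρ : Measure ℝ≥0)
    [IsFiniteMeasure ρ] :
    Integrable (fun l : ℝ≥0 => energyDist (fun t => Real.exp (-(l * t))) μ ν) ρ :=
  (((integrable_exp_neg_mul_sq_norm_sub ρ).integral_prod_left.const_mul 2).sub
    (integrable_exp_neg_mul_sq_norm_sub ρ).integral_prod_left).sub
    (integrable_exp_neg_mul_sq_norm_sub ρ).integral_prod_left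

theorem energyDist_integral_exp [IsFiniteMeasure μ] [IsFiniteMeasure ν] (ρ : Measure ℝ≥0)
    [IsFiniteMeasure ρ] :
    energyDist (fun t => ∫ l, Real.exp (-(l * t)) ∂ρ) μ ν =
      ∫ l : ℝ≥0, energyDist (fun t => Real.exp (-(l * t))) μ ν ∂ρ := by
  have fubini (μ ν : Measure E) [IsFiniteMeasure μ] [IsFiniteMeasure ν] :
      meanGap (fun t => ∫ l, Real.exp (-(l * t)) ∂ρ) μ ν =
        ∫ l : ℝ≥0, meanGap (fun t => Real.exp (-(l * t))) μ ν ∂ρ :=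
    (integral_integral_swap (integrable_exp_neg_mul_sq_norm_sub ρ)).symm
  have integrable (μ ν : Measure E) [IsFiniteMeasure μ] [IsFiniteMeasure ν] :
      Integrable (fun l : ℝ≥0 => meanGap (fun t => Real.exp (-(l * t))) μ ν) ρ :=
    (integrable_exp_neg_mul_sq_norm_sub ρ).integral_prod_left
  simp only [energyDist, fubini]
  rw [integral_sub (((integrable μ ν).const_mul 2).sub' (integrable μ μ)) (integrable ν ν),
    integral_sub ((integrable μ ν).const_mul 2) (integrable μ μ), integral_const_mul]

theorem CompletelyMonotone.energyDist_nonpos [IsFiniteMeasure μ] [IsFiniteMeasure ν]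
    (hf : CompletelyMonotone f) (hc : ContinuousOn f (Set.Ici 0)) : energyDist f μ ν ≤ 0 := by
  obtain ⟨ρ, _, hρ⟩ := hf.exists_isFiniteMeasure_eq_integral_exp hc
  rw [energyDist_congr hρ, energyDist_integral_exp]
  exact integral_nonpos fun l => energyDist_exp_nonpos μ ν l.2

theorem CompletelyMonotone.energyDist_neg [IsFiniteMeasure μ] [IsFiniteMeasure ν]
    (hf : CompletelyMonotone f) (hc : ContinuousOn f (Set.Ici 0))
    (hconst : ∃ t, 0 ≤ t ∧ f t ≠ f 0) (hne : μ ≠ ν) : energyDist f μ ν < 0 := by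
  obtain ⟨ρ, _, hρ⟩ := hf.exists_isFiniteMeasure_eq_integral_exp hc
  refine (hf.energyDist_nonpos hc).lt_of_ne fun hzero => ?_
  rw [energyDist_congr hρ, energyDist_integral_exp, ← neg_eq_zero, ← integral_neg,
    integral_eq_zero_iff_of_nonneg (fun l => neg_nonneg.mpr (energyDist_exp_nonpos μ ν l.2))
      (integrable_energyDist_exp ρ).neg] at hzero
  have concentrated : ∀ᵐ l ∂ρ, l = 0 := by
    filter_upwards [hzero] with l hl
    by_contra hl0
    exact (energyDist_exp_neg hne (NNReal.coe_pos.mpr (pos_iff_ne_zero.mpr hl0))).ne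
      (neg_eq_zero.mp hl)
  obtain ⟨t, ht, hft⟩ := hconst
  refine hft ?_
  rw [hρ t ht, hρ 0 le_rfl]
  exact integral_congr_ae (concentrated.mono fun l hl => by simp [hl])

theorem energyDist_const_mul_nonneg [IsProbabilityMeasure μ] [IsProbabilityMeasure ν] {c : ℝ}
    (hc : 0 ≤ c) (hfin : EnergyFinite (fun t => c * t) μ ν) :
    0 ≤ energyDist (fun t => c * t) μ ν := by
  set F : ℝ → ℝ → ℝ := fun h t => c * (h⁻¹ * (1 - Real.exp (-(h * t))))
  have dominated {h t : ℝ} (hh : 0 < h) (ht : 0 ≤ t) : |F h t| ≤ c * t := by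
    have lower : Real.exp (-(h * t)) ≤ 1 := Real.exp_le_one_iff.mpr (neg_nonpos.mpr (by positivity))
    have upper : 1 - Real.exp (-(h * t)) ≤ h * t := by
      linarith [Real.add_one_le_exp (-(h * t))]
    rw [abs_of_nonneg (mul_nonneg hc (mul_nonneg (inv_nonneg.mpr hh.le) (sub_nonneg.mpr lower)))]
    gcongr
    rwa [inv_mul_le_iff₀ hh]
  have limit : Tendsto (fun h => energyDist (F h) μ ν) (𝓝[>] 0)
      (𝓝 (energyDist (fun t => c * t) μ ν)) :=
    tendsto_energyDist (Eventually.of_forall fun h => by fun_prop) hfin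
      (eventually_mem_nhdsWithin.mono fun h hh t => dominated hh)
      fun t _ => (tendsto_inv_mul_one_sub_exp t).const_mul c
  refine ge_of_tendsto limit (eventually_mem_nhdsWithin.mono fun h (hh : 0 < h) => ?_)
  have hexp : EnergyFinite (fun t => Real.exp (-(h * t))) μ ν :=
    (EnergyFinite.const 1).mono (by fun_prop) fun t ht => by
      rw [Real.abs_exp, Real.exp_le_one_iff, neg_nonpos]
      positivity
  rw [energyDist_const_mul, energyDist_const_mul, energyDist_sub (EnergyFinite.const 1) hexp,
    energyDist_const]
  have := energyDist_exp_nonpos μ ν hh.le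
  exact mul_nonneg hc (mul_nonneg (inv_nonneg.mpr hh.le) (by linarith))

end CompletelyMonotoneEnergy

section EnergyGenerator

open Filter Topology

/-- The translate of `γ` by `a`, shifted vertically so as to vanish at `0` again. For an energy
generator `γ` it interpolates between `γ` itself (`a = 0`) and a linear function (`a → ∞`). -/
noncomputable def centeredTranslate (γ : ℝ → ℝ) (a t : ℝ) : ℝ :=
  γ (t + a) - γ a

variable {γ : ℝ → ℝ} (hγ : IsEnergyGenerator γ)
include hγ

namespace IsEnergyGenerator

theorem centeredTranslate_zero : centeredTranslate γ 0 = γ := by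
  funext t
  simp only [centeredTranslate, add_zero, hγ.map_zero, sub_zero]

theorem continuousOn_comp_add {a : ℝ} (ha : 0 ≤ a) :
    ContinuousOn (fun t => γ (t + a)) (Set.Ici 0) :=
  hγ.continuousOn.comp (by fun_prop) fun _ ht => add_nonneg (Set.mem_Ici.mp ht) ha

theorem hasDerivAt_comp_add {a t : ℝ} (h : 0 < t + a) :
    HasDerivAt (fun t => γ (t + a)) (deriv γ (t + a)) t :=
  (hγ.differentiableOn.differentiableAt (Ioi_mem_nhds h)).hasDerivAt.comp_add_const t a

theorem completelyMonotone_increment {a b : ℝ} (ha : 0 ≤ a) (hab : a ≤ b) :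
    CompletelyMonotone (fun t => γ (t + b) - γ (t + a)) := by
  have hd (t : ℝ) (ht : 0 < t) : HasDerivAt (fun t => γ (t + b) - γ (t + a))
      (deriv γ (t + b) - deriv γ (t + a)) t :=
    (hγ.hasDerivAt_comp_add (by linarith)).sub (hγ.hasDerivAt_comp_add (by linarith))
  refine CompletelyMonotone.of_neg_deriv
    (fun t ht => (hd t ht).differentiableAt.differentiableWithinAt) (fun t ht => ?_) ?_
  · exact sub_nonneg.mpr (hγ.monotoneOn (Set.mem_Ici.mpr (by linarith))
      (Set.mem_Ici.mpr (by linarith)) (by linarith))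
  · refine ((hγ.completelyMonotone_deriv.sub_comp_add (sub_nonneg.mpr hab)).comp_add ha).congr
      fun t ht => ?_
    simp only [(hd t ht).deriv, add_assoc, add_sub_cancel, neg_sub]

theorem continuousOn_increment {a b : ℝ} (ha : 0 ≤ a) (hb : 0 ≤ b) :
    ContinuousOn (fun t => γ (t + b) - γ (t + a)) (Set.Ici 0) :=
  (hγ.continuousOn_comp_add hb).sub (hγ.continuousOn_comp_add ha)

theorem exists_increment_ne :
    ∃ h, 0 ≤ h ∧ ∃ t, 0 ≤ t ∧ γ (t + h) - γ (t + 0) ≠ γ (0 + h) - γ (0 + 0) := by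
  obtain ⟨s, t, hs, hst, hlt⟩ : ∃ s t, 0 < s ∧ s ≤ t ∧ deriv γ t ≠ deriv γ s := by
    by_contra! h
    refine hγ.deriv_nonconstant ⟨deriv γ 1, fun t ht => ?_⟩
    rcases le_total t 1 with h1 | h1
    · exact (h t 1 ht h1).symm
    · exact h 1 t one_pos h1
  refine ⟨t - s, sub_nonneg.mpr hst, ?_⟩
  by_contra! hconst
  have hderiv : HasDerivAt (fun x => γ (x + (t - s)) - γ (x + 0))
      (deriv γ (s + (t - s)) - deriv γ (s + 0)) s :=
    (hγ.hasDerivAt_comp_add (by linarith)).sub (hγ.hasDerivAt_comp_add (by linarith))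
  have hzero : deriv γ (s + (t - s)) - deriv γ (s + 0) = 0 :=
    hderiv.unique ((hasDerivAt_const s _).congr_of_eventuallyEq
      (Filter.mem_of_superset (Ioi_mem_nhds hs) fun x hx => hconst x (le_of_lt hx)))
  exact hlt (by simpa [sub_eq_zero] using hzero)

theorem abs_centeredTranslate_le {a t : ℝ} (ha : 0 ≤ a) (ht : 0 ≤ t) :
    |centeredTranslate γ a t| ≤ γ t := by
  have decreasing := (hγ.completelyMonotone_increment le_rfl ha).antitoneOn_Ici
    (hγ.continuousOn_increment le_rfl ha) Set.self_mem_Ici ht ht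
  simp only [add_zero, zero_add, hγ.map_zero] at decreasing
  rw [centeredTranslate, abs_of_nonneg (sub_nonneg.mpr
    (hγ.monotoneOn ha (add_nonneg ht ha) (le_add_of_nonneg_left ht)))]
  linarith

theorem exists_tendsto_centeredTranslate :
    ∃ c, 0 ≤ c ∧ ∀ t, 0 ≤ t → Tendsto (fun a => centeredTranslate γ a t) atTop (𝓝 (c * t)) := by
  obtain ⟨c, hc, hlim⟩ := hγ.completelyMonotone_deriv.exists_tendsto_atTop
  refine ⟨c, hc, fun t ht => ?_⟩
  rcases ht.eq_or_lt with rfl | ht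
  · simp [centeredTranslate]
  have mean_value (a : ℝ) (ha : 0 < a) :
      ∃ x, a < x ∧ deriv γ x * t = centeredTranslate γ a t := by
    obtain ⟨x, hx, hslope⟩ := exists_deriv_eq_slope γ (lt_add_of_pos_left a ht)
      (hγ.continuousOn.mono fun x hx => ha.le.trans hx.1)
      (hγ.differentiableOn.mono fun x hx => ha.trans hx.1)
    refine ⟨x, hx.1, ?_⟩
    rw [hslope, add_sub_cancel_right, div_mul_cancel₀ _ ht.ne', centeredTranslate]
  choose! x hx hslope using mean_value
  have hx_top : Tendsto x atTop atTop :=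
    tendsto_atTop_mono' _ ((eventually_gt_atTop 0).mono fun a ha => (hx a ha).le) tendsto_id
  exact ((hlim.comp hx_top).mul_const t).congr' ((eventually_gt_atTop 0).mono hslope)

variable {E : Type*} [NormedAddCommGroup E] [InnerProductSpace ℝ E] [FiniteDimensional ℝ E]
  [MeasurableSpace E] [BorelSpace E] {μ ν : Measure E}

theorem continuousOn_centeredTranslate {a : ℝ} (ha : 0 ≤ a) :
    ContinuousOn (centeredTranslate γ a) (Set.Ici 0) :=
  (hγ.continuousOn_comp_add ha).sub continuousOn_const

theorem energyFinite_centeredTranslate (hfin : EnergyFinite γ μ ν) {a : ℝ} (ha : 0 ≤ a) :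
    EnergyFinite (centeredTranslate γ a) μ ν :=
  hfin.mono (hγ.continuousOn_centeredTranslate ha) fun _ ht => hγ.abs_centeredTranslate_le ha ht

variable [IsProbabilityMeasure μ] [IsProbabilityMeasure ν] (hfin : EnergyFinite γ μ ν)
include hfin

theorem energyDist_increment {a b : ℝ} (ha : 0 ≤ a) (hb : 0 ≤ b) :
    energyDist (fun t => γ (t + b) - γ (t + a)) μ ν =
      energyDist (centeredTranslate γ b) μ ν - energyDist (centeredTranslate γ a) μ ν := by
  have hfa := hγ.energyFinite_centeredTranslate hfin ha
  have hfb := hγ.energyFinite_centeredTranslate hfin hb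
  have recenter : (fun t => γ (t + b) - γ (t + a)) =
      fun t => (centeredTranslate γ b t - centeredTranslate γ a t) - (γ a - γ b) := by
    funext t
    simp only [centeredTranslate]
    ring
  rw [recenter, energyDist_sub (hfb.sub hfa) (EnergyFinite.const _), energyDist_sub hfb hfa,
    energyDist_const, sub_zero]

theorem energyDist_centeredTranslate_anti {a b : ℝ} (ha : 0 ≤ a) (hab : a ≤ b) :
    energyDist (centeredTranslate γ b) μ ν ≤ energyDist (centeredTranslate γ a) μ ν := by
  have hb := ha.trans hab
  rw [← sub_nonpos, ← hγ.energyDist_increment hfin ha hb]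
  exact (hγ.completelyMonotone_increment ha hab).energyDist_nonpos (hγ.continuousOn_increment ha hb)

theorem energyDist_centeredTranslate_nonneg {a : ℝ} (ha : 0 ≤ a) :
    0 ≤ energyDist (centeredTranslate γ a) μ ν := by
  obtain ⟨c, hc, hlim⟩ := hγ.exists_tendsto_centeredTranslate
  have nonneg_eventually : ∀ᶠ b : ℝ in atTop, 0 ≤ b := eventually_ge_atTop 0
  have hlinear : EnergyFinite (fun t => c * t) μ ν := by
    refine hfin.mono (by fun_prop) fun t ht => le_of_tendsto (hlim t ht).abs ?_
    exact nonneg_eventually.mono fun b hb => hγ.abs_centeredTranslate_le hb ht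
  have limit : Tendsto (fun b => energyDist (centeredTranslate γ b) μ ν) atTop
      (𝓝 (energyDist (fun t => c * t) μ ν)) :=
    tendsto_energyDist (nonneg_eventually.mono fun b => hγ.continuousOn_centeredTranslate) hfin
      (nonneg_eventually.mono fun b hb t => hγ.abs_centeredTranslate_le hb) hlim
  calc 0 ≤ energyDist (fun t => c * t) μ ν := energyDist_const_mul_nonneg hc hlinear
    _ ≤ energyDist (centeredTranslate γ a) μ ν := le_of_tendsto limit <|
        (eventually_ge_atTop a).mono fun b => hγ.energyDist_centeredTranslate_anti hfin ha

theorem energyDist_pos (hne : μ ≠ ν) : 0 < energyDist γ μ ν := by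
  obtain ⟨h, hh, hconst⟩ := hγ.exists_increment_ne
  have increment_neg := (hγ.completelyMonotone_increment le_rfl hh).energyDist_neg
    (hγ.continuousOn_increment le_rfl hh) hconst hne
  rw [hγ.energyDist_increment hfin le_rfl hh, hγ.centeredTranslate_zero] at increment_neg
  linarith [hγ.energyDist_centeredTranslate_nonneg hfin hh]

end IsEnergyGenerator

end EnergyGenerator

section Pairings

open Finset

section Finpartition

variable {α : Type*} [DecidableEq α]

theorem exists_finpartition_forall_card_eq {A : Finset α} {m : ℕ} (hA : m ∣ #A) :
    ∃ P : Finpartition A, ∀ p ∈ P.parts, #p = m := by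
  obtain ⟨n, hn⟩ := hA
  have hsize : n * m + 0 * (m + 1) = #A := by linarith
  refine ⟨(⊥ : Finpartition A).equitabilise hsize, fun p hp => ?_⟩
  refine (Finpartition.card_eq_of_mem_parts_equitabilise hp).resolve_right ?_
  exact filter_eq_empty_iff.mp (card_eq_zero.mp (Finpartition.card_filter_equitabilise_big _ _)) hp

theorem exists_finpartition_forall_card_eq_superset {A : Finset α} {m : ℕ} (hm : m ≠ 0)
    (hA : m ∣ #A) {S : Finset (Finset α)} (hS : ∀ p ∈ S, p ⊆ A) (hcard : ∀ p ∈ S, #p = m)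
    (hdisj : (S : Set (Finset α)).PairwiseDisjoint id) :
    ∃ P : Finpartition A, (∀ p ∈ P.parts, #p = m) ∧ S ⊆ P.parts := by
  have hsub : S.sup id ⊆ A := Finset.sup_le hS
  have hrest : m ∣ #(A \ S.sup id) := by
    rw [card_sdiff_of_subset hsub, sup_eq_biUnion, card_biUnion hdisj,
      sum_const_nat (f := fun p => #(id p)) hcard]
    exact Nat.dvd_sub hA (dvd_mul_left m _)
  obtain ⟨Q, hQ⟩ := exists_finpartition_forall_card_eq hrest
  have hcard' : ∀ p ∈ S ∪ Q.parts, #p = m := fun p hp => (mem_union.mp hp).elim (hcard p) (hQ p)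
  have hdisj' : (↑(S ∪ Q.parts) : Set (Finset α)).PairwiseDisjoint id := by
    rw [coe_union]
    exact hdisj.union Q.disjoint fun p hp q hq _ =>
      disjoint_sdiff.mono (le_sup (f := id) hp) (Q.le hq)
  have hsup : (S ∪ Q.parts).sup id = A := by
    rw [sup_union, Q.sup_parts]
    exact union_sdiff_of_subset hsub
  let P := (Finpartition.ofPairwiseDisjoint _ hdisj').copy hsup
  have hP : P.parts = S ∪ Q.parts := erase_eq_of_notMem fun h => hm (hcard' ∅ h).symm
  exact ⟨P, by rwa [hP], hP ▸ subset_union_left⟩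

end Finpartition

variable {α M : Type*} [AddCommMonoid M] {w : α → M} {S P : Finset α}

theorem sum_inter_eq_sum_of_forall_notMem_eq_zero [DecidableEq α]
    (hzero : ∀ p ∈ P, p ∉ S → w p = 0) :
    ∑ p ∈ S ∩ P, w p = ∑ p ∈ P, w p :=
  sum_subset inter_subset_right fun p hp hpS =>
    hzero p hp fun h => hpS (mem_inter.mpr ⟨h, hp⟩)

variable [PartialOrder M] [IsOrderedCancelAddMonoid M]

theorem sum_le_sum_of_forall_mem_pos (hpos : ∀ p ∈ S, 0 < w p)
    (hzero : ∀ p ∈ P, p ∉ S → w p = 0) : ∑ p ∈ P, w p ≤ ∑ p ∈ S, w p := by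
  classical
  rw [← sum_inter_eq_sum_of_forall_notMem_eq_zero hzero]
  exact sum_le_sum_of_subset_of_nonneg inter_subset_left fun p hp _ => (hpos p hp).le

theorem sum_eq_sum_iff_subset_of_forall_mem_pos (hpos : ∀ p ∈ S, 0 < w p)
    (hzero : ∀ p ∈ P, p ∉ S → w p = 0) : ∑ p ∈ P, w p = ∑ p ∈ S, w p ↔ S ⊆ P := by
  classical
  rw [← sum_inter_eq_sum_of_forall_notMem_eq_zero hzero]
  refine ⟨fun h => ?_, fun h => by rw [inter_eq_left.mpr h]⟩
  by_contra hSP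
  obtain ⟨p, hp, hpP⟩ := not_subset.mp hSP
  exact h.not_lt (sum_lt_sum_of_subset inter_subset_left hp
    (fun h => hpP (mem_inter.mp h).2) (hpos p hp) fun q hq _ => (hpos q hq).le)

end Pairings

section PairEnergy

variable {d : ℕ}

theorem measurable_subvector (p : Finset (Fin d)) : Measurable (subvector p) :=
  (MeasurableEquiv.toLp 2 _).measurable.comp (by fun_prop)

instance isProbabilityMeasure_jointLaw (F : Measure (Fin d → ℝ)) [IsProbabilityMeasure F]
    (p : Finset (Fin d)) : IsProbabilityMeasure (jointLaw F p) :=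
  Measure.isProbabilityMeasure_map (measurable_subvector p).aemeasurable

theorem exists_measurable_comp_eq_subvector_pair (a b : Fin d) :
    ∃ g : ℝ × ℝ → EuclideanSpace ℝ ({a, b} : Finset (Fin d)), Measurable g ∧
      subvector {a, b} = g ∘ fun x => (x a, x b) := by
  refine ⟨fun u => WithLp.toLp 2 fun k => if k = a then u.1 else u.2, ?_, ?_⟩
  · refine (MeasurableEquiv.toLp 2 _).measurable.comp (measurable_pi_lambda _ fun k => ?_)
    split_ifs
    exacts [measurable_fst, measurable_snd]
  · ext x ⟨k, hk⟩
    rw [Finset.mem_insert, Finset.mem_singleton] at hk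
    rcases hk with rfl | rfl <;> simp +contextual [subvector]

variable {F G H : Measure (Fin d → ℝ)} {a b : Fin d}

theorem jointLaw_pair_eq_of_indepFun [IsFiniteMeasure F] [IsFiniteMeasure G]
    (ha : marginalLaw F a = marginalLaw G a) (hb : marginalLaw F b = marginalLaw G b)
    (hF : IndepFun (fun x => x a) (fun x => x b) F)
    (hG : IndepFun (fun x => x a) (fun x => x b) G) :
    jointLaw F {a, b} = jointLaw G {a, b} := by
  obtain ⟨g, hg, hsub⟩ := exists_measurable_comp_eq_subvector_pair a b
  have jointLaw_eq (H : Measure (Fin d → ℝ)) [IsFiniteMeasure H]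
      (hH : IndepFun (fun x => x a) (fun x => x b) H) :
      jointLaw H {a, b} = ((marginalLaw H a).prod (marginalLaw H b)).map g := by
    rw [jointLaw, hsub, ← Measure.map_map hg (by fun_prop), marginalLaw, marginalLaw,
      ← (indepFun_iff_map_prod_eq_prod_map_map (measurable_pi_apply a).aemeasurable
        (measurable_pi_apply b).aemeasurable).mp hH]
  rw [jointLaw_eq F hF, jointLaw_eq G hG, ha, hb]

theorem indepFun_coordinate_of_indepFun_subvector {β : Type*} [MeasurableSpace β]
    {Y : (Fin d → ℝ) → β} {p : Finset (Fin d)} (h : IndepFun (subvector p) Y H) (ha : a ∈ p) :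
    IndepFun (fun x => x a) Y H :=
  h.comp (φ := fun y : EuclideanSpace ℝ p => y ⟨a, ha⟩) (by fun_prop) measurable_id

variable {s : ℕ} {i j : Fin s → Fin d} {p : Finset (Fin d)}

theorem exists_mem_signalPairs_of_notMem_noiseCoords (ha : a ∉ noiseCoords i j) :
    ∃ p ∈ signalPairs i j, a ∈ p := by
  rcases not_not.mp ha with ⟨k, rfl⟩ | ⟨k, rfl⟩ <;>
    exact ⟨{i k, j k}, Finset.mem_image_of_mem _ (Finset.mem_univ k), by simp⟩

theorem SignalIndependence.indepFun_of_notMem_noiseCoords (hH : SignalIndependence i j H)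
    (hab : ∀ p ∈ signalPairs i j, a ∈ p → b ∉ p) (ha : a ∉ noiseCoords i j) :
    IndepFun (fun x => x a) (fun x => x b) H := by
  obtain ⟨p, hp, hap⟩ := exists_mem_signalPairs_of_notMem_noiseCoords ha
  refine indepFun_coordinate_of_indepFun_subvector ?_ hap
  by_cases hb : b ∈ noiseCoords i j
  · exact hH.signal_noise p hp b hb
  · obtain ⟨q, hq, hbq⟩ := exists_mem_signalPairs_of_notMem_noiseCoords hb
    have hpq : p ≠ q := fun h => hab p hp hap (h ▸ hbq)
    exact (indepFun_coordinate_of_indepFun_subvector (hH.signal_signal q hq p hp hpq.symm) hbq).symm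

theorem card_of_mem_signalPairs (hij : Function.Injective (Sum.elim i j))
    (hp : p ∈ signalPairs i j) : p.card = 2 := by
  obtain ⟨k, -, rfl⟩ := Finset.mem_image.mp hp
  exact Finset.card_pair (hij.ne (Sum.inl_ne_inr (a := k) (b := k)))

theorem disjoint_signalPair (hij : Function.Injective (Sum.elim i j)) {k l : Fin s}
    (hkl : k ≠ l) : Disjoint ({i k, j k} : Finset (Fin d)) {i l, j l} := by
  have hii : i k ≠ i l := hij.ne (Sum.inl_injective.ne hkl)
  have hjj : j k ≠ j l := hij.ne (Sum.inr_injective.ne hkl)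
  have hcross (k l : Fin s) : i k ≠ j l := hij.ne (Sum.inl_ne_inr (a := k) (b := l))
  simp [hii.symm, hjj.symm, hcross, (hcross _ _).symm]

theorem sum_signalPairs {M : Type*} [AddCommMonoid M] (hij : Function.Injective (Sum.elim i j))
    (w : Finset (Fin d) → M) : ∑ p ∈ signalPairs i j, w p = ∑ k, w {i k, j k} := by
  refine Finset.sum_image fun k _ l _ hkl => ?_
  by_contra hne
  exact (disjoint_signalPair hij hne).ne (Finset.insert_ne_empty _ _) hkl

theorem exists_perfectPairing_signalPairs_subset (hd : Even d)
    (hij : Function.Injective (Sum.elim i j)) :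
    ∃ P : PerfectPairing d, signalPairs i j ⊆ P.pairs := by
  have hdisj : (signalPairs i j : Set (Finset (Fin d))).PairwiseDisjoint id := by
    intro p hp q hq hpq
    obtain ⟨k, -, rfl⟩ := Finset.mem_image.mp hp
    obtain ⟨l, -, rfl⟩ := Finset.mem_image.mp hq
    exact disjoint_signalPair hij fun h => hpq (h ▸ rfl)
  obtain ⟨P, hP, hSP⟩ := exists_finpartition_forall_card_eq_superset two_ne_zero
    (by simpa using hd.two_dvd) (fun p _ => Finset.subset_univ p)
    (fun p hp => card_of_mem_signalPairs hij hp) hdisj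
  exact ⟨⟨P, hP⟩, hSP⟩

namespace PairedSignalSetting

variable {γ : ℝ → ℝ} (hset : PairedSignalSetting i j F G)
include hset

theorem jointLaw_eq_of_notMem [IsFiniteMeasure F] [IsFiniteMeasure G]
    (hF : SignalIndependence i j F) (hG : SignalIndependence i j G) (hcard : p.card = 2)
    (hp : p ∉ signalPairs i j) : jointLaw F p = jointLaw G p := by
  obtain ⟨a, b, hab, rfl⟩ := Finset.card_eq_two.mp hcard
  have not_both {q : Finset (Fin d)} (hq : q ∈ signalPairs i j) (ha : a ∈ q) (hb : b ∈ q) :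
      False := by
    refine hp ?_
    have hsub : {a, b} ⊆ q := Finset.insert_subset ha (Finset.singleton_subset_iff.mpr hb)
    rwa [Finset.eq_of_subset_of_card_le hsub
      (by rw [hcard, card_of_mem_signalPairs hset.distinct hq])]
  by_cases ha : a ∈ noiseCoords i j
  · by_cases hb : b ∈ noiseCoords i j
    · exact hset.noise_eq a ha b hb hab
    · exact jointLaw_pair_eq_of_indepFun (hset.marginal_eq a) (hset.marginal_eq b)
        (hF.indepFun_of_notMem_noiseCoords (fun q hq hbq haq => not_both hq haq hbq) hb).symm
        (hG.indepFun_of_notMem_noiseCoords (fun q hq hbq haq => not_both hq haq hbq) hb).symm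
  · exact jointLaw_pair_eq_of_indepFun (hset.marginal_eq a) (hset.marginal_eq b)
      (hF.indepFun_of_notMem_noiseCoords (fun q hq => not_both hq) ha)
      (hG.indepFun_of_notMem_noiseCoords (fun q hq => not_both hq) ha)

theorem pairEnergy_eq_zero_of_notMem [IsFiniteMeasure F] [IsFiniteMeasure G]
    (hF : SignalIndependence i j F) (hG : SignalIndependence i j G) (hcard : p.card = 2)
    (hp : p ∉ signalPairs i j) : pairEnergy γ F G p = 0 := by
  rw [pairEnergy, hset.jointLaw_eq_of_notMem hF hG hcard hp, energyDist_self]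

theorem pairEnergy_pos [IsProbabilityMeasure F] [IsProbabilityMeasure G]
    (hγ : IsEnergyGenerator γ) (hfin : EnergyFinite γ (jointLaw F p) (jointLaw G p))
    (hp : p ∈ signalPairs i j) : 0 < pairEnergy γ F G p :=
  hγ.energyDist_pos hfin (hset.signal_ne p hp)

end PairedSignalSetting

end PairEnergy

theorem mainTheorem5 {d s : ℕ} (hd : Even d)
    (γ : ℝ → ℝ) (hγ : IsEnergyGenerator γ)
    (F G : Measure (Fin d → ℝ)) [IsProbabilityMeasure F] [IsProbabilityMeasure G]
    (hfin : ∀ p : Finset (Fin d), p.card = 2 → EnergyFinite γ (jointLaw F p) (jointLaw G p))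
    (i j : Fin s → Fin d)
    (hset : PairedSignalSetting i j F G)
    (hF : SignalIndependence i j F) (hG : SignalIndependence i j G) :
    IsGreatest (Set.range (totalEnergy γ F G)) (∑ p ∈ signalPairs i j, pairEnergy γ F G p) ∧
      ∑ p ∈ signalPairs i j, pairEnergy γ F G p =
        ∑ k : Fin s, pairEnergy γ F G {i k, j k} ∧
      ∀ P : PerfectPairing d,
        IsMaxOn (totalEnergy γ F G) Set.univ P ↔ signalPairs i j ⊆ P.pairs := by
  have hpos : ∀ p ∈ signalPairs i j, 0 < pairEnergy γ F G p := fun p hp =>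
    hset.pairEnergy_pos hγ (hfin p (card_of_mem_signalPairs hset.distinct hp)) hp
  have hzero (P : PerfectPairing d) :
      ∀ p ∈ P.pairs, p ∉ signalPairs i j → pairEnergy γ F G p = 0 := fun p hp =>
    hset.pairEnergy_eq_zero_of_notMem hF hG (P.2 p hp)
  have hle (P : PerfectPairing d) :
      totalEnergy γ F G P ≤ ∑ p ∈ signalPairs i j, pairEnergy γ F G p :=
    sum_le_sum_of_forall_mem_pos hpos (hzero P)
  have heq (P : PerfectPairing d) :
      totalEnergy γ F G P = ∑ p ∈ signalPairs i j, pairEnergy γ F G p ↔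
        signalPairs i j ⊆ P.pairs :=
    sum_eq_sum_iff_subset_of_forall_mem_pos hpos (hzero P)
  obtain ⟨P₀, hP₀⟩ := exists_perfectPairing_signalPairs_subset hd hset.distinct
  have hmax : IsGreatest (Set.range (totalEnergy γ F G)) _ :=
    ⟨⟨P₀, (heq P₀).mpr hP₀⟩, Set.forall_mem_range.mpr hle⟩
  refine ⟨hmax, sum_signalPairs hset.distinct _, fun P => ?_⟩
  refine Iff.trans ⟨fun h => ?_, fun h Q _ => ?_⟩ (heq P)
  · exact (hle P).antisymm (((heq P₀).mpr hP₀).ge.trans (h (Set.mem_univ P₀)))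
  · exact (hle Q).trans_eq h.symm
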